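/- A configuration on a finite connected graph $G$ is a function from $V(G)$ to the non-negative integers (the number of pebbles on each vertex). A pebbling move removes two pebbles from some vertex and places one of them on an adjacent vertex (the other is discarded). A set $D$ of vertices is dominating if every vertex of $G$ is in $D$ or adjacent to an element of $D$. The domination cover pebbling number $\psi(G)$ is the least $k$ such that every configuration of $k$ pebbles on $G$ can be transformed, by a finite (possibly empty) sequence of pebbling moves, into a configuration whose set of vertices carrying at least one pebble is dominating. Let $B_n$ be the complete binary tree of height $n$: it has $2^i$ vertices at distance $i$ from the root for $0\le i\le n$, and every vertex at distance less than $n$ from the root has exactly two children. Theorem 7. $\psi(B_0)=1$, $\psi(B_1)=2$, $\psi(B_2)=11$, $\psi(B_3)=81$ and $\psi(B_4)=609$. -/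

import Mathlib

/-! ### Domination cover pebbling -/

/-- A pebbling move on `G` from the configuration `C` to the configuration `C'`: two pebbles are
removed from a vertex `u`, one of them is placed on a vertex `v` adjacent to `u` (the other one is
discarded), and all other vertices keep their pebbles. -/
def PebblingMove {V : Type*} (G : SimpleGraph V) (C C' : V → ℕ) : Prop :=
  ∃ u v : V, G.Adj u v ∧ C u = C' u + 2 ∧ C' v = C v + 1 ∧ ∀ w : V, w ≠ u → w ≠ v → C' w = C w

/-- `C'` is obtained from `C` by a finite (possibly empty) sequence of pebbling moves. -/
def PebblingReachable {V : Type*} (G : SimpleGraph V) : (V → ℕ) → (V → ℕ) → Prop :=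
  Relation.ReflTransGen (PebblingMove G)

/-- Every vertex of `G` is in `D` or adjacent to some element of `D`. -/
def IsDominatingSet {V : Type*} (G : SimpleGraph V) (D : Set V) : Prop :=
  ∀ v : V, v ∈ D ∨ ∃ w ∈ D, G.Adj v w

/-- The configuration `C` can be transformed by pebbling moves so that the set of vertices that
carry pebbles is a dominating set. -/
def HasDominationCover {V : Type*} (G : SimpleGraph V) (C : V → ℕ) : Prop :=
  ∃ C' : V → ℕ, PebblingReachable G C C' ∧ IsDominatingSet G {v | 0 < C' v}

/-- The domination cover pebbling number `ψ(G)`: the least `k` such that every configuration of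
`k` pebbles on `G` can be transformed into a domination cover. -/
noncomputable def dominationCoverPebblingNumber {V : Type*} [Fintype V] (G : SimpleGraph V) : ℕ :=
  sInf {k : ℕ | ∀ C : V → ℕ, ∑ v, C v = k → HasDominationCover G C}

/-! ### Complete binary trees -/

/-- The vertices of the complete binary tree of height `n`: the root and, when the height is
positive, the vertices of two copies (indexed by `Bool`) of the tree of height one less. -/
inductive BinTreeVertex : ℕ → Type
  | root {n : ℕ} : BinTreeVertex n
  | inSubtree {n : ℕ} (b : Bool) (v : BinTreeVertex n) : BinTreeVertex (n + 1)

namespace BinTreeVertex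

/-- The unique vertex of the tree of height zero is its root. -/
def equivZero : BinTreeVertex 0 ≃ Unit where
  toFun _ := ()
  invFun _ := root
  left_inv v := by cases v; rfl
  right_inv _ := rfl

/-- The tree of height `n + 1` consists of its root and two copies of the tree of height `n`. -/
def equivSucc (n : ℕ) : BinTreeVertex (n + 1) ≃ Option (Bool × BinTreeVertex n) where
  toFun v := match v with
    | root => none
    | inSubtree b w => some (b, w)
  invFun x := match x with
    | none => root
    | some (b, w) => inSubtree b w
  left_inv v := by cases v <;> rfl
  right_inv x := by rcases x with _ | ⟨b, w⟩ <;> rfl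

/-- The vertex set of the tree of height `n` is finite. -/
instance instFintype : (n : ℕ) → Fintype (BinTreeVertex n)
  | 0 => Fintype.ofEquiv Unit equivZero.symm
  | n + 1 =>
    letI := instFintype n
    Fintype.ofEquiv (Option (Bool × BinTreeVertex n)) (equivSucc n).symm

/-- `IsChild u v`: the vertex `v` is a child of the vertex `u`. The children of the root are the
roots of the two copies below it. -/
inductive IsChild : {n : ℕ} → BinTreeVertex n → BinTreeVertex n → Prop
  | root {n : ℕ} (b : Bool) : IsChild (root : BinTreeVertex (n + 1)) (inSubtree b root)
  | inSubtree {n : ℕ} (b : Bool) {u v : BinTreeVertex n} (h : IsChild u v) :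
      IsChild (inSubtree b u) (inSubtree b v)

theorem IsChild.ne {n : ℕ} {u v : BinTreeVertex n} (h : IsChild u v) : u ≠ v := by
  induction h with
  | root b => exact fun e => by cases e
  | inSubtree b h ih => exact fun e => ih (by cases e; rfl)

end BinTreeVertex

/-- The complete binary tree `B_n` of height `n`; two vertices are adjacent when one of them is a
child of the other. -/
def completeBinaryTree (n : ℕ) : SimpleGraph (BinTreeVertex n) where
  Adj u v := BinTreeVertex.IsChild u v ∨ BinTreeVertex.IsChild v u
  symm := ⟨fun _ _ h => h.symm⟩
  loopless := ⟨fun _ h => h.elim (fun h => h.ne rfl) (fun h => h.ne rfl)⟩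

/-! The question is settled by a recursion on subtrees. Every subtree is summarised by the most
pebbles it can send out of its root, a negative number being the supply it needs, under three
demands on that root: it carries a pebble, it is dominated from within, or nothing is asked of it.
With `t` pebbles to spare, a root sends out half of them, rounded down; if `t` is negative it needs
`-t`, and its parent pays double. At a root that keeps a pebble the children are free (`und`);
otherwise each child must be dominated within its own subtree (`dom`), and the root is dominated if
one child carries a pebble (`cov`).

These flows decide coverability exactly (`hasDominationCover_iff`). They never increase under a move
(`netFlow_pebblingMove`) and are nonnegative, where demanded, once the configuration dominates
(`netFlow_nonneg`). Conversely each flow is realised by actual moves (`exists_reachableWithOutput`).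

The upper bounds on `ψ` then follow by bounding the pebbles in a subtree by a piecewise linear
function of its flows, height by height. The lower bounds come from one pile on a leaf and a single
pebble on a leaf of every other subtree of height one. Those single pebbles are wasted: such a
subtree has the same flows, all equal to -1, as an empty one. The pile has to send a pebble to the
root of each subtree of height one, and from height three on one more near the top, at a cost of `2
^ d` for distance `d`; the pile is one pebble short of this. -/

open BinTreeVertex

/-! ### Net flows and their recursion on subtrees -/

/-- What a neighbour of a vertex gains when the subtree behind that neighbour has net output `x`:
a deficit has to be paid for twice. -/
def pebbleGain (x : ℤ) : ℤ := if 0 ≤ x then x else 2 * x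

/-- The number of pebbles that a vertex with `t` spare pebbles can send to a neighbour; when `t` is
negative, `-t` is the number of pebbles that it needs to receive. -/
def pebbleOutput (t : ℤ) : ℤ := if 0 ≤ t then t / 2 else t

/-- The maximal net numbers of pebbles that a rooted tree can send out from its root while all
its vertices other than the root are dominated from within, and moreover the root carries a pebble
(`cov`), the root is dominated (`dom`), nothing is required of the root (`und`). -/
structure NetFlow where
  cov : ℤ
  dom : ℤ
  und : ℤ

/-- The net flows of a tree whose root carries `r` pebbles, from those of its two subtrees. -/
def NetFlow.combine (r : ℤ) (a b : NetFlow) : NetFlow where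
  cov := pebbleOutput (r - 1 + pebbleGain a.und + pebbleGain b.und)
  dom := max (pebbleOutput (r - 1 + pebbleGain a.und + pebbleGain b.und))
    (pebbleOutput (r + max (pebbleGain a.cov + pebbleGain b.dom)
      (pebbleGain a.dom + pebbleGain b.cov)))
  und := max (max (pebbleOutput (r - 1 + pebbleGain a.und + pebbleGain b.und))
    (pebbleOutput (r + max (pebbleGain a.cov + pebbleGain b.dom)
      (pebbleGain a.dom + pebbleGain b.cov))))
    (pebbleOutput (r + pebbleGain a.dom + pebbleGain b.dom))

/-- The net flows of a configuration on a complete binary tree. -/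
def netFlow : (n : ℕ) → (BinTreeVertex n → ℕ) → NetFlow
  -- A lone vertex can be dominated from within only by its own pebble, so `cov` and `dom` agree.
  | 0, C => ⟨pebbleOutput (C root - 1), pebbleOutput (C root - 1), pebbleOutput (C root)⟩
  | n + 1, C => NetFlow.combine (C root) (netFlow n fun v => C (inSubtree false v))
      (netFlow n fun v => C (inSubtree true v))

/-- The configuration with `r` pebbles on the root and configurations `f b` on the subtrees. -/
def glueConfig {n : ℕ} (r : ℕ) (f : Bool → BinTreeVertex n → ℕ) : BinTreeVertex (n + 1) → ℕ
  | root => r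
  | inSubtree b v => f b v

@[simp] theorem glueConfig_root {n : ℕ} (r : ℕ) (f : Bool → BinTreeVertex n → ℕ) :
    glueConfig r f root = r := rfl

@[simp] theorem glueConfig_inSubtree {n : ℕ} (r : ℕ) (f : Bool → BinTreeVertex n → ℕ) (b : Bool)
    (v : BinTreeVertex n) : glueConfig r f (inSubtree b v) = f b v := rfl

theorem exists_eq_glueConfig {n : ℕ} (C : BinTreeVertex (n + 1) → ℕ) :
    ∃ r f, C = glueConfig r f :=
  ⟨C root, fun b v => C (inSubtree b v), by funext v; cases v <;> rfl⟩

theorem netFlow_glueConfig {n : ℕ} (r : ℕ) (f : Bool → BinTreeVertex n → ℕ) :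
    netFlow (n + 1) (glueConfig r f) =
      NetFlow.combine r (netFlow n (f false)) (netFlow n (f true)) := rfl

/-! ### Adjacency in complete binary trees -/

theorem adj_inSubtree_inSubtree {n : ℕ} {b c : Bool} {u v : BinTreeVertex n} :
    (completeBinaryTree (n + 1)).Adj (inSubtree b u) (inSubtree c v) ↔
      b = c ∧ (completeBinaryTree n).Adj u v := by
  constructor
  · rintro (h | h)
    · cases h with
      | inSubtree b h => exact ⟨rfl, Or.inl h⟩
    · cases h with
      | inSubtree b h => exact ⟨rfl, Or.inr h⟩
  · rintro ⟨rfl, h | h⟩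
    · exact Or.inl (.inSubtree b h)
    · exact Or.inr (.inSubtree b h)

theorem adj_root_inSubtree {n : ℕ} {b : Bool} {v : BinTreeVertex n} :
    (completeBinaryTree (n + 1)).Adj root (inSubtree b v) ↔ v = root := by
  constructor
  · rintro (h | h)
    · cases h; rfl
    · cases h
  · rintro rfl
    exact Or.inl (.root b)

theorem adj_inSubtree_root {n : ℕ} {b : Bool} {v : BinTreeVertex n} :
    (completeBinaryTree (n + 1)).Adj (inSubtree b v) root ↔ v = root := by
  rw [SimpleGraph.adj_comm, adj_root_inSubtree]

theorem not_adj_root_root {n : ℕ} : ¬ (completeBinaryTree n).Adj root root :=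
  (completeBinaryTree n).loopless.irrefl _

/-! ### Net flows do not increase under pebbling moves -/

theorem pebbleOutput_mono : Monotone pebbleOutput := by
  intro s t h
  simp only [pebbleOutput]
  split_ifs <;> omega

theorem pebbleOutput_add_one_le (t : ℤ) : pebbleOutput (t + 1) ≤ pebbleOutput t + 1 := by
  simp only [pebbleOutput]
  split_ifs <;> omega

theorem pebbleOutput_add_one_le_add_two (t : ℤ) : pebbleOutput t + 1 ≤ pebbleOutput (t + 2) := by
  simp only [pebbleOutput]
  split_ifs <;> omega

theorem pebbleGain_mono : Monotone pebbleGain := by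
  intro s t h
  simp only [pebbleGain]
  split_ifs <;> omega

theorem pebbleGain_le_add_two {s t : ℤ} (h : s ≤ t + 1) : pebbleGain s ≤ pebbleGain t + 2 := by
  simp only [pebbleGain]
  split_ifs <;> omega

theorem pebbleGain_add_one_le {s t : ℤ} (h : s + 1 ≤ t) : pebbleGain s + 1 ≤ pebbleGain t := by
  simp only [pebbleGain]
  split_ifs <;> omega

theorem pebbleOutput_nonneg {t : ℤ} (h : 0 ≤ t) : 0 ≤ pebbleOutput t := by
  simp only [pebbleOutput, if_pos h]
  omega

theorem pebbleGain_nonneg {t : ℤ} (h : 0 ≤ t) : 0 ≤ pebbleGain t := by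
  simpa only [pebbleGain, if_pos h] using h

/-- The net flows `a` are bounded by `b`, with an error of `e`. -/
def NetFlow.LeAdd (e : ℤ) (a b : NetFlow) : Prop :=
  a.cov ≤ b.cov + e ∧ a.dom ≤ b.dom + e ∧ a.und ≤ b.und + e

/-- The gains from the net flows `a` are bounded by those from `b`, with an error of `e`. -/
def NetFlow.GainLeAdd (e : ℤ) (a b : NetFlow) : Prop :=
  pebbleGain a.cov ≤ pebbleGain b.cov + e ∧ pebbleGain a.dom ≤ pebbleGain b.dom + e ∧
    pebbleGain a.und ≤ pebbleGain b.und + e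

theorem NetFlow.LeAdd.refl (a : NetFlow) : NetFlow.LeAdd 0 a a := by
  simp [NetFlow.LeAdd]

theorem NetFlow.LeAdd.gain {a b : NetFlow} (h : NetFlow.LeAdd 0 a b) :
    NetFlow.GainLeAdd 0 a b := by
  obtain ⟨h1, h2, h3⟩ := h
  rw [add_zero] at h1 h2 h3
  refine ⟨?_, ?_, ?_⟩ <;> rw [add_zero] <;> apply pebbleGain_mono <;> assumption

theorem NetFlow.LeAdd.gain_one {a b : NetFlow} (h : NetFlow.LeAdd 1 a b) :
    NetFlow.GainLeAdd 2 a b :=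
  ⟨pebbleGain_le_add_two h.1, pebbleGain_le_add_two h.2.1, pebbleGain_le_add_two h.2.2⟩

theorem NetFlow.LeAdd.gain_neg_one {a b : NetFlow} (h : NetFlow.LeAdd (-1) a b) :
    NetFlow.GainLeAdd (-1) a b := by
  obtain ⟨h1, h2, h3⟩ := h
  have k1 := pebbleGain_add_one_le (s := a.cov) (t := b.cov) (by omega)
  have k2 := pebbleGain_add_one_le (s := a.dom) (t := b.dom) (by omega)
  have k3 := pebbleGain_add_one_le (s := a.und) (t := b.und) (by omega)
  refine ⟨?_, ?_, ?_⟩ <;> omega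

/-- Whatever the gains of the subtrees rise by is taken from the root, so the spare count under each
option does not grow. Comparing before the output is rounded is what allows an error of 0. -/
theorem NetFlow.combine_leAdd {r r' e e' : ℤ} {a a' b b' : NetFlow} (hr : r' + e + e' ≤ r)
    (ha : NetFlow.GainLeAdd e a' a) (hb : NetFlow.GainLeAdd e' b' b) :
    NetFlow.LeAdd 0 (NetFlow.combine r' a' b') (NetFlow.combine r a b) := by
  obtain ⟨a1, a2, a3⟩ := ha
  obtain ⟨b1, b2, b3⟩ := hb
  have hc : pebbleOutput (r' - 1 + pebbleGain a'.und + pebbleGain b'.und) ≤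
      pebbleOutput (r - 1 + pebbleGain a.und + pebbleGain b.und) :=
    pebbleOutput_mono (by omega)
  have hd : pebbleOutput (r' + max (pebbleGain a'.cov + pebbleGain b'.dom)
        (pebbleGain a'.dom + pebbleGain b'.cov)) ≤
      pebbleOutput (r + max (pebbleGain a.cov + pebbleGain b.dom)
        (pebbleGain a.dom + pebbleGain b.cov)) :=
    pebbleOutput_mono (by omega)
  have hu : pebbleOutput (r' + pebbleGain a'.dom + pebbleGain b'.dom) ≤
      pebbleOutput (r + pebbleGain a.dom + pebbleGain b.dom) :=
    pebbleOutput_mono (by omega)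
  simp only [NetFlow.LeAdd, NetFlow.combine, add_zero]
  exact ⟨hc, max_le_max hc hd, max_le_max (max_le_max hc hd) hu⟩

theorem NetFlow.combine_add_one (r : ℤ) (a b : NetFlow) :
    NetFlow.LeAdd 1 (NetFlow.combine (r + 1) a b) (NetFlow.combine r a b) := by
  have h1 := pebbleOutput_add_one_le (r - 1 + pebbleGain a.und + pebbleGain b.und)
  have h2 := pebbleOutput_add_one_le (r + max (pebbleGain a.cov + pebbleGain b.dom)
    (pebbleGain a.dom + pebbleGain b.cov))
  have h3 := pebbleOutput_add_one_le (r + pebbleGain a.dom + pebbleGain b.dom)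
  simp only [NetFlow.LeAdd, NetFlow.combine]
  rw [show r + 1 - 1 + pebbleGain a.und + pebbleGain b.und =
      r - 1 + pebbleGain a.und + pebbleGain b.und + 1 by ring, add_right_comm r 1,
    add_right_comm r 1, add_right_comm _ 1]
  omega

theorem NetFlow.combine_leAdd_add_two (r : ℤ) (a b : NetFlow) :
    NetFlow.LeAdd (-1) (NetFlow.combine r a b) (NetFlow.combine (r + 2) a b) := by
  have h1 := pebbleOutput_add_one_le_add_two (r - 1 + pebbleGain a.und + pebbleGain b.und)
  have h2 := pebbleOutput_add_one_le_add_two (r + max (pebbleGain a.cov + pebbleGain b.dom)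
    (pebbleGain a.dom + pebbleGain b.cov))
  have h3 := pebbleOutput_add_one_le_add_two (r + pebbleGain a.dom + pebbleGain b.dom)
  simp only [NetFlow.LeAdd, NetFlow.combine]
  rw [show r + 2 - 1 + pebbleGain a.und + pebbleGain b.und =
      r - 1 + pebbleGain a.und + pebbleGain b.und + 2 by ring, add_right_comm r 2,
    add_right_comm r 2, add_right_comm _ 2]
  omega

/-- A pebble arriving from the parent raises the flows by at most 1, hence the gains by at most 2,
which is what the parent paid for it. -/
theorem netFlow_root_add_one {n : ℕ} {C C' : BinTreeVertex n → ℕ} (hr : C' root = C root + 1)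
    (h : ∀ v, v ≠ root → C' v = C v) : NetFlow.LeAdd 1 (netFlow n C') (netFlow n C) := by
  cases n with
  | zero =>
    have h1 := pebbleOutput_add_one_le ((C root : ℤ) - 1)
    have h2 := pebbleOutput_add_one_le (C root : ℤ)
    simp only [NetFlow.LeAdd, netFlow, hr, Nat.cast_add, Nat.cast_one]
    rw [show (C root : ℤ) + 1 - 1 = C root - 1 + 1 by ring]
    exact ⟨h1, h1, h2⟩
  | succ n =>
    have e : ∀ b, (fun v => C' (inSubtree b v)) = fun v => C (inSubtree b v) :=
      fun b => funext fun v => h _ (by simp)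
    simp only [netFlow, e, hr, Nat.cast_add, Nat.cast_one]
    exact NetFlow.combine_add_one _ _ _

theorem netFlow_root_add_two {n : ℕ} {C C' : BinTreeVertex n → ℕ} (hr : C root = C' root + 2)
    (h : ∀ v, v ≠ root → C' v = C v) : NetFlow.LeAdd (-1) (netFlow n C') (netFlow n C) := by
  cases n with
  | zero =>
    have h1 := pebbleOutput_add_one_le_add_two ((C' root : ℤ) - 1)
    have h2 := pebbleOutput_add_one_le_add_two (C' root : ℤ)
    simp only [NetFlow.LeAdd, netFlow, hr, Nat.cast_add, Nat.cast_ofNat]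
    rw [show (C' root : ℤ) + 2 - 1 = C' root - 1 + 2 by ring]
    omega
  | succ n =>
    have e : ∀ b, (fun v => C' (inSubtree b v)) = fun v => C (inSubtree b v) :=
      fun b => funext fun v => h _ (by simp)
    simp only [netFlow, e, hr, Nat.cast_add, Nat.cast_ofNat]
    exact NetFlow.combine_leAdd_add_two _ _ _

theorem netFlow_glueConfig_leAdd {n : ℕ} {r r' : ℕ} {f f' : Bool → BinTreeVertex n → ℕ} (e : ℤ)
    (b : Bool) (hr : r' + e ≤ r)
    (hb : NetFlow.GainLeAdd e (netFlow n (f' b)) (netFlow n (f b))) (hf : f' (!b) = f (!b)) :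
    NetFlow.LeAdd 0 (netFlow (n + 1) (glueConfig r' f')) (netFlow (n + 1) (glueConfig r f)) := by
  rw [netFlow_glueConfig, netFlow_glueConfig]
  cases b
  · refine NetFlow.combine_leAdd (e := e) (e' := 0) (by omega) hb ?_
    rw [show f' true = f true from hf]
    exact (NetFlow.LeAdd.refl _).gain
  · refine NetFlow.combine_leAdd (e := 0) (e' := e) (by omega) ?_ hb
    rw [show f' false = f false from hf]
    exact (NetFlow.LeAdd.refl _).gain

/-- A move across an edge at the root is balanced there: downwards, the root loses 2 and the gain of
the subtree rises by at most 2; upwards, the root receives 1 and the gain falls by at least 1. Moves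
inside a subtree are handled by induction, which needs all three flows because `combine` mixes them.
-/
theorem netFlow_pebblingMove {n : ℕ} {C C' : BinTreeVertex n → ℕ}
    (h : PebblingMove (completeBinaryTree n) C C') :
    NetFlow.LeAdd 0 (netFlow n C') (netFlow n C) := by
  induction n with
  | zero =>
    obtain ⟨u, v, hadj, -⟩ := h
    cases u; cases v
    exact absurd hadj not_adj_root_root
  | succ n ih =>
    obtain ⟨r, f, rfl⟩ := exists_eq_glueConfig C
    obtain ⟨r', f', rfl⟩ := exists_eq_glueConfig C'
    obtain ⟨u, v, hadj, hu, hv, hw⟩ := h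
    rcases u with _ | ⟨b, u⟩ <;> rcases v with _ | ⟨c, v⟩
    · exact absurd hadj not_adj_root_root
    · obtain rfl := adj_root_inSubtree.1 hadj
      simp only [glueConfig_root, glueConfig_inSubtree] at hu hv
      refine netFlow_glueConfig_leAdd 2 c (by omega) ?_ ?_
      · exact (netFlow_root_add_one hv fun w h =>
          hw (inSubtree c w) (by simp) (by simpa using h)).gain_one
      · exact funext fun w => hw (inSubtree (!c) w) (by simp) (by simp)
    · obtain rfl := adj_inSubtree_root.1 hadj
      simp only [glueConfig_root, glueConfig_inSubtree] at hu hv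
      refine netFlow_glueConfig_leAdd (-1) b (by omega) ?_ ?_
      · exact (netFlow_root_add_two hu fun w h =>
          hw (inSubtree b w) (by simpa using h) (by simp)).gain_neg_one
      · exact funext fun w => hw (inSubtree (!b) w) (by simp) (by simp)
    · obtain ⟨rfl, huv⟩ := adj_inSubtree_inSubtree.1 hadj
      have hr : r' = r := hw root (by simp) (by simp)
      refine netFlow_glueConfig_leAdd 0 b (by omega) ?_ ?_
      · exact (ih ⟨u, v, huv, hu, hv, fun w h1 h2 =>
          hw (inSubtree b w) (by simpa using h1) (by simpa using h2)⟩).gain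
      · exact funext fun w => hw (inSubtree (!b) w) (by simp) (by simp)

theorem netFlow_dom_le_of_reachable {n : ℕ} {C C' : BinTreeVertex n → ℕ}
    (h : PebblingReachable (completeBinaryTree n) C C') :
    (netFlow n C').dom ≤ (netFlow n C).dom := by
  induction h with
  | refl => exact le_rfl
  | tail _ hmove ih =>
    have := (netFlow_pebblingMove hmove).2.1
    omega

/-! ### Net flows of dominating configurations -/

/-- The vertex `v` carries a pebble or is adjacent to a vertex that does. -/
def IsDominatedIn {n : ℕ} (C : BinTreeVertex n → ℕ) (v : BinTreeVertex n) : Prop :=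
  0 < C v ∨ ∃ w, 0 < C w ∧ (completeBinaryTree n).Adj v w

theorem isDominatedIn_root {n : ℕ} {r : ℕ} {f : Bool → BinTreeVertex n → ℕ} :
    IsDominatedIn (glueConfig r f) root ↔ 0 < r ∨ ∃ b, 0 < f b root := by
  constructor
  · rintro (h | ⟨_ | ⟨b, w⟩, h, hadj⟩)
    · exact Or.inl h
    · exact absurd hadj not_adj_root_root
    · obtain rfl := adj_root_inSubtree.1 hadj
      exact Or.inr ⟨b, h⟩
  · rintro (h | ⟨b, h⟩)
    · exact Or.inl h
    · exact Or.inr ⟨inSubtree b root, h, adj_root_inSubtree.2 rfl⟩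

theorem isDominatedIn_inSubtree {n : ℕ} {r : ℕ} {f : Bool → BinTreeVertex n → ℕ} {b : Bool}
    {v : BinTreeVertex n} :
    IsDominatedIn (glueConfig r f) (inSubtree b v) ↔
      IsDominatedIn (f b) v ∨ v = root ∧ 0 < r := by
  constructor
  · rintro (h | ⟨_ | ⟨c, w⟩, h, hadj⟩)
    · exact Or.inl (Or.inl h)
    · exact Or.inr ⟨adj_inSubtree_root.1 hadj, h⟩
    · obtain ⟨rfl, hvw⟩ := adj_inSubtree_inSubtree.1 hadj
      exact Or.inl (Or.inr ⟨w, h, hvw⟩)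
  · rintro ((h | ⟨w, h, hadj⟩) | ⟨rfl, h⟩)
    · exact Or.inl h
    · exact Or.inr ⟨inSubtree b w, h, adj_inSubtree_inSubtree.2 ⟨rfl, hadj⟩⟩
    · exact Or.inr ⟨root, h, adj_inSubtree_root.2 rfl⟩

/-- All vertices except possibly the root are dominated. -/
def DominatesNonRoot {n : ℕ} (C : BinTreeVertex n → ℕ) : Prop :=
  ∀ v, v ≠ root → IsDominatedIn C v

theorem isDominatingSet_iff {n : ℕ} {C : BinTreeVertex n → ℕ} :
    IsDominatingSet (completeBinaryTree n) {v | 0 < C v} ↔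
      DominatesNonRoot C ∧ IsDominatedIn C root := by
  constructor
  · exact fun h => ⟨fun v _ => h v, h root⟩
  · rintro ⟨h, hr⟩ v
    by_cases hv : v = root
    · exact hv ▸ hr
    · exact h v hv

theorem dominatesNonRoot_glueConfig {n : ℕ} {r : ℕ} {f : Bool → BinTreeVertex n → ℕ} :
    DominatesNonRoot (glueConfig r f) ↔
      ∀ b, DominatesNonRoot (f b) ∧ (IsDominatedIn (f b) root ∨ 0 < r) := by
  constructor
  · intro h b
    refine ⟨fun v hv => ?_, ?_⟩
    · exact (isDominatedIn_inSubtree.1 (h (inSubtree b v) (by simp))).resolve_right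
        fun h => hv h.1
    · exact (isDominatedIn_inSubtree.1 (h (inSubtree b root) (by simp))).imp_right And.right
  · rintro h (_ | ⟨b, v⟩) hv
    · exact absurd rfl hv
    · rw [isDominatedIn_inSubtree]
      by_cases hv : v = root
      · subst hv
        exact (h b).2.imp_right fun h => ⟨rfl, h⟩
      · exact Or.inl ((h b).1 v hv)

/-- If the root carries a pebble, the `und` flows of the subtrees suffice. If not, both subtrees
must dominate their own roots, and a dominated root has a child with a pebble, whose `cov` flow is
then available. -/
theorem netFlow_nonneg {n : ℕ} {C : BinTreeVertex n → ℕ} (h : DominatesNonRoot C) :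
    0 ≤ (netFlow n C).und ∧ (IsDominatedIn C root → 0 ≤ (netFlow n C).dom) ∧
      (0 < C root → 0 ≤ (netFlow n C).cov) := by
  induction n with
  | zero =>
    have hc : 0 < C root → 0 ≤ (netFlow 0 C).cov := fun h => by
      simp only [netFlow]
      exact pebbleOutput_nonneg (by omega)
    refine ⟨?_, ?_, hc⟩
    · simp only [netFlow]
      exact pebbleOutput_nonneg (Int.natCast_nonneg _)
    · rintro (h | ⟨w, -, hadj⟩)
      · exact hc h
      · cases w
        exact absurd hadj not_adj_root_root
  | succ n ih =>
    obtain ⟨r, f, rfl⟩ := exists_eq_glueConfig C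
    rw [dominatesNonRoot_glueConfig] at h
    rw [netFlow_glueConfig, isDominatedIn_root, glueConfig_root]
    have ih' := fun b => ih (h b).1
    have hc : 0 < r → 0 ≤ pebbleOutput ((r : ℤ) - 1 + pebbleGain (netFlow n (f false)).und +
        pebbleGain (netFlow n (f true)).und) := by
      intro hr
      have h1 := pebbleGain_nonneg (ih' false).1
      have h2 := pebbleGain_nonneg (ih' true).1
      exact pebbleOutput_nonneg (by omega)
    by_cases hr : 0 < r
    · exact ⟨le_max_of_le_left (le_max_of_le_left (hc hr)), fun _ => le_max_of_le_left (hc hr),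
        fun _ => hc hr⟩
    · have hd := fun b => pebbleGain_nonneg ((ih' b).2.1 ((h b).2.resolve_right hr))
      have h1 := hd false
      have h2 := hd true
      refine ⟨le_max_of_le_right (pebbleOutput_nonneg (by omega)), ?_, fun h => absurd h hr⟩
      intro hroot
      obtain ⟨b, hb⟩ := hroot.resolve_left hr
      have h3 := pebbleGain_nonneg ((ih' b).2.2 hb)
      refine le_max_of_le_right (pebbleOutput_nonneg ?_)
      cases b <;> omega

theorem netFlow_dom_nonneg_of_hasDominationCover {n : ℕ} {C : BinTreeVertex n → ℕ}
    (h : HasDominationCover (completeBinaryTree n) C) : 0 ≤ (netFlow n C).dom := by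
  obtain ⟨C', hreach, hdom⟩ := h
  rw [isDominatingSet_iff] at hdom
  exact ((netFlow_nonneg hdom.1).2.1 hdom.2).trans (netFlow_dom_le_of_reachable hreach)

/-! ### Net flows are attained -/

theorem PebblingReachable.refl {V : Type*} (G : SimpleGraph V) (C : V → ℕ) :
    PebblingReachable G C C :=
  Relation.ReflTransGen.refl

theorem pebblingMove_add {V : Type*} {G : SimpleGraph V} {C C' : V → ℕ} (D : V → ℕ)
    (h : PebblingMove G C C') : PebblingMove G (C + D) (C' + D) := by
  obtain ⟨u, v, hadj, hu, hv, hw⟩ := h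
  refine ⟨u, v, hadj, ?_, ?_, fun w h1 h2 => ?_⟩
  · simp only [Pi.add_apply]; omega
  · simp only [Pi.add_apply]; omega
  · simp only [Pi.add_apply, hw w h1 h2]

theorem pebblingReachable_add {V : Type*} {G : SimpleGraph V} {C C' : V → ℕ} (D : V → ℕ)
    (h : PebblingReachable G C C') : PebblingReachable G (C + D) (C' + D) :=
  Relation.ReflTransGen.lift (· + D) (fun _ _ => pebblingMove_add D) _ _ h

/-- Add `k` pebbles on the root. -/
def addRoot {n : ℕ} (k : ℕ) (C : BinTreeVertex n → ℕ) : BinTreeVertex n → ℕ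
  | root => C root + k
  | inSubtree b v => C (inSubtree b v)

@[simp] theorem addRoot_root {n : ℕ} (k : ℕ) (C : BinTreeVertex n → ℕ) :
    addRoot k C root = C root + k := by
  cases n <;> rfl

theorem addRoot_of_ne {n : ℕ} (k : ℕ) (C : BinTreeVertex n → ℕ) {v : BinTreeVertex n}
    (h : v ≠ root) : addRoot k C v = C v := by
  cases v
  · exact absurd rfl h
  · rfl

@[simp] theorem addRoot_zero {n : ℕ} (C : BinTreeVertex n → ℕ) : addRoot 0 C = C := by
  funext v
  cases v <;> rfl

@[simp] theorem addRoot_glueConfig {n : ℕ} (k r : ℕ) (f : Bool → BinTreeVertex n → ℕ) :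
    addRoot k (glueConfig r f) = glueConfig (r + k) f := by
  funext v
  cases v <;> rfl

theorem reachable_glueConfig_update {n : ℕ} {r : ℕ} {f : Bool → BinTreeVertex n → ℕ} {b : Bool}
    {A A' : BinTreeVertex n → ℕ} (h : PebblingReachable (completeBinaryTree n) A A') :
    PebblingReachable (completeBinaryTree (n + 1)) (glueConfig r (Function.update f b A))
      (glueConfig r (Function.update f b A')) := by
  refine Relation.ReflTransGen.lift (fun A => glueConfig r (Function.update f b A)) ?_ _ _ h
  rintro A A' ⟨u, v, hadj, hu, hv, hw⟩
  refine ⟨inSubtree b u, inSubtree b v, adj_inSubtree_inSubtree.2 ⟨rfl, hadj⟩, by simpa, by simpa,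
    ?_⟩
  rintro (_ | ⟨c, w⟩) h1 h2
  · rfl
  · by_cases hc : c = b
    · subst hc
      simpa using hw w (by simpa using h1) (by simpa using h2)
    · simp [Function.update_of_ne hc]

theorem reachable_toRoot {n : ℕ} {f : Bool → BinTreeVertex n → ℕ} {b : Bool}
    {A : BinTreeVertex n → ℕ} (r x : ℕ) :
    PebblingReachable (completeBinaryTree (n + 1))
      (glueConfig r (Function.update f b (addRoot (2 * x) A)))
      (glueConfig (r + x) (Function.update f b A)) := by
  induction x generalizing r with
  | zero => simpa using PebblingReachable.refl _ _
  | succ x ih =>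
    refine Relation.ReflTransGen.head ?_ ((congrArg (PebblingReachable _ _)
      (by rw [show r + 1 + x = r + (x + 1) by ring])).mp (ih (r + 1)))
    refine ⟨inSubtree b root, root, adj_inSubtree_root.2 rfl, ?_, rfl, ?_⟩
    · simp only [glueConfig_inSubtree, Function.update_self, addRoot_root]
      ring
    · rintro (_ | ⟨c, w⟩) h1 h2
      · exact absurd rfl h2
      · by_cases hc : c = b
        · subst hc
          have hw : w ≠ root := fun h => h1 (h ▸ rfl)
          simp [addRoot_of_ne _ _ hw]
        · simp [Function.update_of_ne hc]

theorem reachable_fromRoot {n : ℕ} {f : Bool → BinTreeVertex n → ℕ} {b : Bool}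
    {A : BinTreeVertex n → ℕ} (r y : ℕ) :
    PebblingReachable (completeBinaryTree (n + 1))
      (glueConfig (r + 2 * y) (Function.update f b A))
      (glueConfig r (Function.update f b (addRoot y A))) := by
  induction y with
  | zero => simpa using PebblingReachable.refl _ _
  | succ y ih =>
    have := pebblingReachable_add (addRoot 2 0) ih
    have e : ∀ (s : ℕ) (g : Bool → BinTreeVertex n → ℕ),
        glueConfig s g + addRoot 2 0 = glueConfig (s + 2) g := by
      intro s g
      funext v
      cases v <;> rfl
    rw [e, e] at this
    refine Relation.ReflTransGen.tail this ?_
    refine ⟨root, inSubtree b root, adj_root_inSubtree.2 rfl, rfl, ?_, ?_⟩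
    · simp only [glueConfig_inSubtree, Function.update_self, addRoot_root]
      ring
    · rintro (_ | ⟨c, w⟩) h1 h2
      · exact absurd rfl h1
      · by_cases hc : c = b
        · subst hc
          have hw : w ≠ root := fun h => h2 (h ▸ rfl)
          simp [addRoot_of_ne _ _ hw]
        · simp [Function.update_of_ne hc]

/-- From `C`, with net output `x` through the root, the configuration `C'` can be reached. -/
def ReachableWithOutput {n : ℕ} (x : ℤ) (C C' : BinTreeVertex n → ℕ) : Prop :=
  PebblingReachable (completeBinaryTree n) (addRoot (-x).toNat C) (addRoot (2 * x.toNat) C')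

/-- A nonnegative output `x` is stored as `2 * x` pebbles on the root of the subtree, the price of
`x` moves to the parent. A negative one means pebbles supplied in advance, for each of which the
parent pays two. -/
theorem ReachableWithOutput.glueConfig_of_nonneg {n : ℕ} {r r' : ℕ}
    {f : Bool → BinTreeVertex n → ℕ} {b : Bool} {A' : BinTreeVertex n → ℕ} {x : ℤ} (hx : 0 ≤ x)
    (h : ReachableWithOutput x (f b) A') (hr : r + x = r') :
    PebblingReachable (completeBinaryTree (n + 1)) (glueConfig r f)
      (glueConfig r' (Function.update f b A')) := by
  rw [ReachableWithOutput, show (-x).toNat = 0 by omega, addRoot_zero] at h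
  have h1 := (reachable_glueConfig_update (r := r) (f := f) (b := b) h).trans
    (reachable_toRoot r x.toNat)
  rwa [Function.update_eq_self, show r + x.toNat = r' by omega] at h1

theorem ReachableWithOutput.glueConfig_of_nonpos {n : ℕ} {r r' : ℕ}
    {f : Bool → BinTreeVertex n → ℕ} {b : Bool} {A' : BinTreeVertex n → ℕ} {x : ℤ} (hx : x ≤ 0)
    (h : ReachableWithOutput x (f b) A') (hr : r + 2 * x = r') :
    PebblingReachable (completeBinaryTree (n + 1)) (glueConfig r f)
      (glueConfig r' (Function.update f b A')) := by
  rw [ReachableWithOutput, show x.toNat = 0 by omega, mul_zero, addRoot_zero] at h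
  have h1 := (reachable_fromRoot (f := f) (b := b) (A := f b) r' (-x).toNat).trans
    (reachable_glueConfig_update h)
  rwa [Function.update_eq_self, show r' + 2 * (-x).toNat = r by omega] at h1

theorem ReachableWithOutput.glueConfig_of_gain {n : ℕ} {r r' : ℕ}
    {f : Bool → BinTreeVertex n → ℕ} {b : Bool} {A' : BinTreeVertex n → ℕ} {x : ℤ}
    (h : ReachableWithOutput x (f b) A') (hr : r + pebbleGain x = r') :
    PebblingReachable (completeBinaryTree (n + 1)) (glueConfig r f)
      (glueConfig r' (Function.update f b A')) := by
  by_cases hx : 0 ≤ x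
  · exact h.glueConfig_of_nonneg hx (by simpa [pebbleGain, hx] using hr)
  · exact h.glueConfig_of_nonpos (by omega) (by simpa [pebbleGain, hx] using hr)

/-- Only the order of the two exchanges matters, since the root may not run into debt in between.
Some order works: if either subtree alone would overdraw the root, both gains are negative and the
final count would be negative too. -/
theorem reachable_glueConfig_of_gain {n : ℕ} {r r' : ℕ} {f f' : Bool → BinTreeVertex n → ℕ}
    {x : Bool → ℤ} (h : ∀ b, ReachableWithOutput (x b) (f b) (f' b))
    (hr : r + pebbleGain (x false) + pebbleGain (x true) = r') :
    PebblingReachable (completeBinaryTree (n + 1)) (glueConfig r f) (glueConfig r' f') := by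
  -- The subtree with the larger output goes first.
  obtain ⟨b, hb⟩ : ∃ b, 0 ≤ r + pebbleGain (x b) := by
    by_contra! hneg
    have h1 := hneg false
    have h2 := hneg true
    simp only [pebbleGain] at *
    split_ifs at * <;> omega
  have hsum : r + pebbleGain (x b) + pebbleGain (x (!b)) = r' := by
    cases b
    · exact hr
    · simp only [Bool.not_true]
      omega
  lift (r + pebbleGain (x b)) to ℕ using hb with s hs
  have h1 := (h b).glueConfig_of_gain hs.symm
  have h2 := ReachableWithOutput.glueConfig_of_gain (r := s) (r' := r')
    (f := Function.update f b (f' b)) (b := !b) (x := x (!b)) (A' := f' (!b))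
    (by rw [Function.update_of_ne (by simp)]; exact h (!b)) hsum
  have e : Function.update (Function.update f b (f' b)) (!b) (f' (!b)) = f' := by
    funext c
    cases b <;> cases c <;> rfl
  rw [e] at h2
  exact h1.trans h2

/-- If the subtrees have net outputs `x b`, then the whole tree has the net output
`pebbleOutput t` with `t` counted after setting `m` pebbles on the root aside. -/
theorem reachableWithOutput_glueConfig {n : ℕ} {r m : ℕ} {f f' : Bool → BinTreeVertex n → ℕ}
    {x : Bool → ℤ} (h : ∀ b, ReachableWithOutput (x b) (f b) (f' b)) {t : ℤ}
    (ht : t = r - m + pebbleGain (x false) + pebbleGain (x true)) :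
    ∃ r', m ≤ r' ∧ ReachableWithOutput (pebbleOutput t) (glueConfig r f) (glueConfig r' f') := by
  -- The difference is what stays on the root beyond the `m` reserved pebbles: the parity of `t` if
  -- `t` is nonnegative, and 0 otherwise.
  have key : 0 ≤ t + (-pebbleOutput t).toNat - 2 * (pebbleOutput t).toNat := by
    simp only [pebbleOutput]
    split_ifs <;> omega
  lift (t + (-pebbleOutput t).toNat - 2 * (pebbleOutput t).toNat) to ℕ using key with k hk
  refine ⟨m + k, by omega, ?_⟩
  rw [ReachableWithOutput, addRoot_glueConfig, addRoot_glueConfig]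
  refine reachable_glueConfig_of_gain h ?_
  push_cast
  omega

theorem reachableWithOutput_zero (C : BinTreeVertex 0 → ℕ) (m : ℕ) :
    ∃ C' : BinTreeVertex 0 → ℕ, m ≤ C' root ∧
      ReachableWithOutput (pebbleOutput ((C root : ℤ) - m)) C C' := by
  set t : ℤ := (C root : ℤ) - m with ht
  have key : 0 ≤ t + (-pebbleOutput t).toNat - 2 * (pebbleOutput t).toNat := by
    simp only [pebbleOutput]
    split_ifs <;> omega
  lift (t + (-pebbleOutput t).toNat - 2 * (pebbleOutput t).toNat) to ℕ using key with k hk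
  refine ⟨fun _ => m + k, Nat.le_add_right m k, ?_⟩
  have e : addRoot (-pebbleOutput t).toNat C =
      addRoot (2 * (pebbleOutput t).toNat) fun _ => m + k := by
    funext v
    cases v
    rw [addRoot_root, addRoot_root]
    omega
  rw [ReachableWithOutput, e]
  exact Relation.ReflTransGen.refl

/-- Each option inside the maxima of `combine` says which demand each child meets. Its value is
realised by letting the subtrees reach the matching configurations and then settling accounts at the
root. -/
theorem exists_reachableWithOutput {n : ℕ} (C : BinTreeVertex n → ℕ) :
    (∃ C', ReachableWithOutput (netFlow n C).cov C C' ∧ DominatesNonRoot C' ∧ 0 < C' root) ∧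
    (∃ C', ReachableWithOutput (netFlow n C).dom C C' ∧ DominatesNonRoot C' ∧
      IsDominatedIn C' root) ∧
    (∃ C', ReachableWithOutput (netFlow n C).und C C' ∧ DominatesNonRoot C') := by
  induction n with
  | zero =>
    have hn : ∀ C : BinTreeVertex 0 → ℕ, DominatesNonRoot C := by
      intro C v hv
      cases v
      exact absurd rfl hv
    obtain ⟨A, hA, hA'⟩ := reachableWithOutput_zero C 1
    obtain ⟨B, -, hB'⟩ := reachableWithOutput_zero C 0
    refine ⟨⟨A, by simpa [netFlow] using hA', hn A, hA⟩,
      ⟨A, by simpa [netFlow] using hA', hn A, Or.inl hA⟩, ⟨B, by simpa [netFlow] using hB', hn B⟩⟩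
  | succ n ih =>
    obtain ⟨r, f, rfl⟩ := exists_eq_glueConfig C
    rw [netFlow_glueConfig]
    choose cov hcov using fun b => (ih (f b)).1
    choose dom hdom using fun b => (ih (f b)).2.1
    choose und hund using fun b => (ih (f b)).2.2
    have hcov' : ∃ C', ReachableWithOutput (pebbleOutput ((r : ℤ) - 1 +
          pebbleGain (netFlow n (f false)).und + pebbleGain (netFlow n (f true)).und))
        (glueConfig r f) C' ∧ DominatesNonRoot C' ∧ 0 < C' root := by
      obtain ⟨r', hr', h⟩ := reachableWithOutput_glueConfig (r := r) (m := 1)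
        (fun b => (hund b).1) (by rw [Nat.cast_one])
      exact ⟨_, h, dominatesNonRoot_glueConfig.2 fun b => ⟨(hund b).2, Or.inr hr'⟩, hr'⟩
    have hdom1 : ∀ b, ∃ C', ReachableWithOutput (pebbleOutput ((r : ℤ) +
          (pebbleGain (netFlow n (f b)).cov + pebbleGain (netFlow n (f (!b))).dom)))
        (glueConfig r f) C' ∧ DominatesNonRoot C' ∧ IsDominatedIn C' root := by
      intro b
      obtain ⟨r', -, h⟩ := reachableWithOutput_glueConfig (r := r) (m := 0) (f := f)
        -- The child on side `b` carries the pebble that dominates the root; the other child only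
        -- has to be dominated within its subtree.
        (f' := fun c => if c = b then cov c else dom c)
        (x := fun c => if c = b then (netFlow n (f c)).cov else (netFlow n (f c)).dom)
        (t := (r : ℤ) + (pebbleGain (netFlow n (f b)).cov + pebbleGain (netFlow n (f (!b))).dom))
        (by
          intro c
          by_cases hc : c = b
          · simpa [hc] using (hcov b).1
          · simpa [hc] using (hdom c).1)
        (by cases b <;> simp <;> ring)
      refine ⟨_, h, dominatesNonRoot_glueConfig.2 fun c => ?_,
        isDominatedIn_root.2 (Or.inr ⟨b, ?_⟩)⟩
      · by_cases hc : c = b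
        · subst hc
          simpa using ⟨(hcov c).2.1, Or.inl (Or.inl (hcov c).2.2)⟩
        · simpa [hc] using ⟨(hdom c).2.1, Or.inl (hdom c).2.2⟩
      · simpa using (hcov b).2.2
    have hdom' : ∃ C', ReachableWithOutput (NetFlow.combine r (netFlow n (f false))
          (netFlow n (f true))).dom (glueConfig r f) C' ∧
        DominatesNonRoot C' ∧ IsDominatedIn C' root := by
      simp only [NetFlow.combine]
      rcases max_choice (pebbleOutput ((r : ℤ) - 1 + pebbleGain (netFlow n (f false)).und +
        pebbleGain (netFlow n (f true)).und)) (pebbleOutput (r + max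
          (pebbleGain (netFlow n (f false)).cov + pebbleGain (netFlow n (f true)).dom)
          (pebbleGain (netFlow n (f false)).dom + pebbleGain (netFlow n (f true)).cov)))
        with h | h <;> rw [h]
      · obtain ⟨C', h1, h2, h3⟩ := hcov'
        exact ⟨C', h1, h2, Or.inl h3⟩
      · rcases max_choice
          (pebbleGain (netFlow n (f false)).cov + pebbleGain (netFlow n (f true)).dom)
          (pebbleGain (netFlow n (f false)).dom + pebbleGain (netFlow n (f true)).cov)
          with h | h <;> rw [h]
        · exact hdom1 false
        · rw [add_comm (pebbleGain _)]
          exact hdom1 true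
    refine ⟨hcov', hdom', ?_⟩
    rcases max_choice (NetFlow.combine r (netFlow n (f false)) (netFlow n (f true))).dom
      (pebbleOutput ((r : ℤ) + pebbleGain (netFlow n (f false)).dom +
        pebbleGain (netFlow n (f true)).dom)) with h | h
    · obtain ⟨C', h1, h2, -⟩ := hdom'
      exact ⟨C', by rw [← h] at h1; exact h1, h2⟩
    · obtain ⟨r', -, h'⟩ := reachableWithOutput_glueConfig (r := r) (m := 0)
        (fun b => (hdom b).1) (by rw [Nat.cast_zero, sub_zero])
      refine ⟨glueConfig r' dom, ?_,
        dominatesNonRoot_glueConfig.2 fun b => ⟨(hdom b).2.1, Or.inl (hdom b).2.2⟩⟩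
      rw [← h] at h'
      exact h'

theorem hasDominationCover_of_netFlow_dom_nonneg {n : ℕ} {C : BinTreeVertex n → ℕ}
    (h : 0 ≤ (netFlow n C).dom) : HasDominationCover (completeBinaryTree n) C := by
  obtain ⟨C', hreach, h1, h2⟩ := (exists_reachableWithOutput C).2.1
  rw [ReachableWithOutput, show (-(netFlow n C).dom).toNat = 0 by omega, addRoot_zero] at hreach
  refine ⟨_, hreach, ?_⟩
  -- The pebbles prepared for output stay on the root; they only enlarge the set of occupied
  -- vertices.
  have hle : ∀ v, C' v ≤ addRoot (2 * (netFlow n C).dom.toNat) C' v := by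
    intro v
    by_cases hv : v = root
    · subst hv
      simp
    · rw [addRoot_of_ne _ _ hv]
  intro v
  rcases isDominatingSet_iff.2 ⟨h1, h2⟩ v with h | ⟨w, h, hadj⟩
  · exact Or.inl (lt_of_lt_of_le h (hle v))
  · exact Or.inr ⟨w, lt_of_lt_of_le h (hle w), hadj⟩

/-- This turns the search over move sequences into arithmetic: linear bounds for all configurations
of a given size, and a finite computation for a single one. -/
theorem hasDominationCover_iff {n : ℕ} {C : BinTreeVertex n → ℕ} :
    HasDominationCover (completeBinaryTree n) C ↔ 0 ≤ (netFlow n C).dom :=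
  ⟨netFlow_dom_nonneg_of_hasDominationCover, hasDominationCover_of_netFlow_dom_nonneg⟩

/-! ### Net flows of configurations with many pebbles -/

theorem sum_zero_height (C : BinTreeVertex 0 → ℕ) : ∑ v, C v = C root := by
  rw [Fintype.sum_equiv equivZero C (fun _ => C root) fun v => by cases v; rfl]
  simp

theorem sum_glueConfig {n : ℕ} (r : ℕ) (f : Bool → BinTreeVertex n → ℕ) :
    ∑ v, glueConfig r f v = r + ∑ v, f false v + ∑ v, f true v := by
  rw [Fintype.sum_equiv (equivSucc n) (glueConfig r f)
    (fun x => x.elim r fun p => f p.1 p.2) fun v => by cases v <;> rfl]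
  rw [Fintype.sum_option, Fintype.sum_prod_type, Fintype.sum_bool]
  simp only [Option.elim]
  omega

theorem netFlow_zero_bounds (C : BinTreeVertex 0 → ℕ) {k : ℕ} (hk : ∑ v, C v = k) :
    netFlow 0 C = ⟨pebbleOutput (k - 1), pebbleOutput (k - 1), pebbleOutput k⟩ := by
  rw [← hk, sum_zero_height]
  rfl

theorem netFlow_one_bounds (C : BinTreeVertex 1 → ℕ) {k : ℕ} (hk : ∑ v, C v = k) :
    -1 ≤ (netFlow 1 C).cov ∧ -1 ≤ (netFlow 1 C).dom ∧ (netFlow 1 C).dom ≤ (netFlow 1 C).und ∧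
      k ≤ 4 * (netFlow 1 C).cov + 6 ∧ k ≤ 4 * (netFlow 1 C).dom + 5 := by
  obtain ⟨r, f, rfl⟩ := exists_eq_glueConfig C
  rw [sum_glueConfig] at hk
  rw [netFlow_glueConfig, netFlow_zero_bounds (f false) rfl, netFlow_zero_bounds (f true) rfl]
  generalize ∑ v, f false v = a at *
  generalize ∑ v, f true v = b at *
  simp only [NetFlow.combine, pebbleGain, pebbleOutput]
  omega

/-- The largest number of spare pebbles for which the net output is `x`. -/
def maxSpare (x : ℤ) : ℤ := if 0 ≤ x then 2 * x + 1 else x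

/-- Inverting the rounding gives, for every option inside a maximum, a linear inequality in each
sign case, so that the maxima need not be evaluated. -/
theorem le_maxSpare {t x : ℤ} (h : pebbleOutput t ≤ x) : t ≤ maxSpare x := by
  simp only [pebbleOutput, maxSpare] at *
  split_ifs at * <;> omega

theorem maxSpare_cases (x : ℤ) : 0 ≤ x ∧ maxSpare x = 2 * x + 1 ∨ x < 0 ∧ maxSpare x = x := by
  simp only [maxSpare]
  split_ifs <;> omega

theorem pebbleGain_cases (x : ℤ) : 0 ≤ x ∧ pebbleGain x = x ∨ x < 0 ∧ pebbleGain x = 2 * x := by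
  simp only [pebbleGain]
  split_ifs <;> omega

namespace NetFlow

variable (r : ℤ) (a b : NetFlow)

theorem le_maxSpare_combine_cov :
    r - 1 + pebbleGain a.und + pebbleGain b.und ≤ maxSpare (combine r a b).cov :=
  le_maxSpare le_rfl

theorem cov_dom_le_maxSpare_combine_dom :
    r + pebbleGain a.cov + pebbleGain b.dom ≤ maxSpare (combine r a b).dom :=
  le_maxSpare (le_max_of_le_right (pebbleOutput_mono (by
    rw [add_assoc]
    exact (add_le_add_iff_left r).2 (le_max_left _ _))))

theorem dom_cov_le_maxSpare_combine_dom :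
    r + pebbleGain a.dom + pebbleGain b.cov ≤ maxSpare (combine r a b).dom :=
  le_maxSpare (le_max_of_le_right (pebbleOutput_mono (by
    rw [add_assoc]
    exact (add_le_add_iff_left r).2 (le_max_right _ _))))

theorem le_maxSpare_combine_und :
    r + pebbleGain a.dom + pebbleGain b.dom ≤ maxSpare (combine r a b).und :=
  le_maxSpare (le_max_of_le_right le_rfl)

end NetFlow

/-- The constants -5 and -4 are the flows of the empty tree. A pebble brought to the root from a
leaf costs 4, and one sent on to the parent costs 8, which are the slopes for negative and
nonnegative flows. The clause with 11 is separate because the linear bound at `dom = -1` would still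
allow 14 pebbles. -/
theorem netFlow_two_bounds (C : BinTreeVertex 2 → ℕ) {k : ℕ} (hk : ∑ v, C v = k) :
    (11 ≤ k → 0 ≤ (netFlow 2 C).dom) ∧ -5 ≤ (netFlow 2 C).cov ∧ -4 ≤ (netFlow 2 C).dom ∧
      (0 ≤ (netFlow 2 C).cov → k ≤ 8 * (netFlow 2 C).cov + 22) ∧
      ((netFlow 2 C).cov < 0 → k ≤ 4 * (netFlow 2 C).cov + 22) ∧
      (0 ≤ (netFlow 2 C).dom → k ≤ 8 * (netFlow 2 C).dom + 18) ∧
      ((netFlow 2 C).dom < 0 → k ≤ 4 * (netFlow 2 C).dom + 18) := by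
  obtain ⟨r, f, rfl⟩ := exists_eq_glueConfig C
  rw [sum_glueConfig] at hk
  rw [netFlow_glueConfig]
  have h1 := netFlow_one_bounds (f false) rfl
  have h2 := netFlow_one_bounds (f true) rfl
  generalize ∑ v, f false v = a at *
  generalize ∑ v, f true v = b at *
  generalize netFlow 1 (f false) = p at *
  generalize netFlow 1 (f true) = q at *
  have hcov := NetFlow.le_maxSpare_combine_cov r p q
  have hdom := NetFlow.cov_dom_le_maxSpare_combine_dom r p q
  have hdom' := NetFlow.dom_cov_le_maxSpare_combine_dom r p q
  generalize NetFlow.combine r p q = s at *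
  -- The bounds `k ≤ 4 * dom + 5` of the two subtrees are added and weakened by `dom ≤ und`.
  have hcov' : k ≤ r + 4 * p.und + 4 * q.und + 10 := by omega
  have hpu := pebbleGain_cases p.und
  have hqu := pebbleGain_cases q.und
  have hpc := pebbleGain_cases p.cov
  have hqc := pebbleGain_cases q.cov
  have hpd := pebbleGain_cases p.dom
  have hqd := pebbleGain_cases q.dom
  have hc : -5 ≤ s.cov ∧ (0 ≤ s.cov → k ≤ 8 * s.cov + 22) ∧
      (s.cov < 0 → k ≤ 4 * s.cov + 22) := by
    rcases maxSpare_cases s.cov with h | h <;> omega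
  have hd : (11 ≤ k → 0 ≤ s.dom) ∧ -4 ≤ s.dom ∧ (0 ≤ s.dom → k ≤ 8 * s.dom + 18) ∧
      (s.dom < 0 → k ≤ 4 * s.dom + 18) := by
    clear hcov hcov' hpu hqu
    rcases maxSpare_cases s.dom with h | h <;> rcases hpc with hpc | hpc <;>
      rcases hqc with hqc | hqc <;> omega
  tauto

/-- Height four needs only `und`. The flow of the empty tree is -16, and four wasted pebbles do not
improve it. The bound for negative flows is the line through 4 pebbles at flow -16 and 92 pebbles at
flow 0, where it meets the bound of slope 16. -/
theorem netFlow_three_bounds (C : BinTreeVertex 3 → ℕ) {k : ℕ} (hk : ∑ v, C v = k) :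
    (81 ≤ k → 0 ≤ (netFlow 3 C).dom) ∧ -16 ≤ (netFlow 3 C).und ∧
      (0 ≤ (netFlow 3 C).und → k ≤ 16 * (netFlow 3 C).und + 92) ∧
      ((netFlow 3 C).und < 0 → 2 * k ≤ 11 * (netFlow 3 C).und + 184) := by
  obtain ⟨r, f, rfl⟩ := exists_eq_glueConfig C
  rw [sum_glueConfig] at hk
  rw [netFlow_glueConfig]
  obtain ⟨-, pc, pd, pc1, pc2, pd1, pd2⟩ := netFlow_two_bounds (f false) rfl
  obtain ⟨-, qc, qd, qc1, qc2, qd1, qd2⟩ := netFlow_two_bounds (f true) rfl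
  generalize ∑ v, f false v = a at *
  generalize ∑ v, f true v = b at *
  generalize netFlow 2 (f false) = p at *
  generalize netFlow 2 (f true) = q at *
  have hdom := NetFlow.cov_dom_le_maxSpare_combine_dom r p q
  have hdom' := NetFlow.dom_cov_le_maxSpare_combine_dom r p q
  have hund := NetFlow.le_maxSpare_combine_und r p q
  generalize NetFlow.combine r p q = s at *
  have hpc := pebbleGain_cases p.cov
  have hqc := pebbleGain_cases q.cov
  have hpd := pebbleGain_cases p.dom
  have hqd := pebbleGain_cases q.dom
  constructor
  · clear hund
    rcases maxSpare_cases s.dom with h | h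
    · omega
    · rcases hpc with hpc | hpc <;> rcases hqc with hqc | hqc <;>
        rcases hpd with hpd | hpd <;> rcases hqd with hqd | hqd <;> omega
  · clear hdom hdom' hpc hqc pc pc1 pc2 qc qc1 qc2
    rcases maxSpare_cases s.und with h | h <;>
      rcases hpd with hpd | hpd <;> rcases hqd with hqd | hqd <;> omega

/-- Keeping a pebble on the root is enough for the sharp bound. In the worst failing case one
subtree has flow -16 with 4 pebbles and the other has flow 32, one short of the required 33, with at
most `16 * 32 + 92 = 604`; together 608. -/
theorem netFlow_four_dom_nonneg (C : BinTreeVertex 4 → ℕ) (hk : 609 ≤ ∑ v, C v) :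
    0 ≤ (netFlow 4 C).dom := by
  obtain ⟨r, f, rfl⟩ := exists_eq_glueConfig C
  rw [sum_glueConfig] at hk
  have h1 := netFlow_three_bounds (f false) rfl
  have h2 := netFlow_three_bounds (f true) rfl
  have h3 := pebbleGain_cases (netFlow 3 (f false)).und
  have h4 := pebbleGain_cases (netFlow 3 (f true)).und
  refine le_max_of_le_left (pebbleOutput_nonneg ?_)
  change 0 ≤ (r : ℤ) - 1 + pebbleGain (netFlow 3 (f false)).und +
    pebbleGain (netFlow 3 (f true)).und
  omega

/-! ### The domination cover pebbling numbers -/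

/-- A number of pebbles that always suffices, and one less pebble placed so that it does not. -/
theorem dominationCoverPebblingNumber_eq_succ {V : Type*} [Fintype V] {G : SimpleGraph V} {k : ℕ}
    (h : ∀ C : V → ℕ, ∑ v, C v = k + 1 → HasDominationCover G C) {C₀ : V → ℕ}
    (hC₀ : ∑ v, C₀ v = k) (hnot : ¬ HasDominationCover G C₀) :
    dominationCoverPebblingNumber G = k + 1 := by
  classical
  set S := {k : ℕ | ∀ C : V → ℕ, ∑ v, C v = k → HasDominationCover G C} with hS
  have hmem : k + 1 ∈ S := h
  -- Membership in `S` concerns exactly `m` pebbles, so failure at `k` excludes smaller numbers only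
  -- once `S` is known to be upward closed. One pebble is set aside and put back at the end.
  have hsucc : ∀ m ∈ S, m + 1 ∈ S := by
    intro m hm C hC
    obtain ⟨u, -, hu⟩ : ∃ u ∈ Finset.univ, 0 < C u := by
      by_contra! hzero
      have := Finset.sum_nonpos hzero
      omega
    have hle : Pi.single u 1 ≤ C := by
      intro v
      by_cases hv : v = u
      · subst hv
        simpa [Nat.one_le_iff_ne_zero, Nat.pos_iff_ne_zero] using hu
      · simp [Pi.single_eq_of_ne hv]
    have hC' : C - Pi.single u 1 + Pi.single u 1 = C := tsub_add_cancel_of_le hle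
    have hsum : ∑ v, (C - Pi.single u 1 : V → ℕ) v = m := by
      have h1 : ∑ v, (C - Pi.single u 1 + Pi.single u 1 : V → ℕ) v = m + 1 := by rw [hC', hC]
      simp only [Pi.add_apply, Finset.sum_add_distrib, Finset.sum_pi_single', Finset.mem_univ,
        if_true] at h1
      omega
    obtain ⟨D, hreach, hdom⟩ := hm _ hsum
    refine ⟨D + Pi.single u 1, ?_, fun v => ?_⟩
    · have := pebblingReachable_add (Pi.single u 1) hreach
      rwa [hC'] at this
    · exact (hdom v).imp (fun hv => Nat.add_pos_left hv _)
        fun ⟨w, hw, hadj⟩ => ⟨w, Nat.add_pos_left hw _, hadj⟩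
  refine le_antisymm (Nat.sInf_le hmem) (le_csInf ⟨_, hmem⟩ fun m hm => ?_)
  by_contra! hlt
  exact hnot (Nat.le_induction hm (fun n _ hn => hsucc n hn) k (Nat.le_of_lt_succ hlt) C₀ hC₀)

/-- The configuration with `k` pebbles on the leftmost leaf and none elsewhere. -/
def leftmostLeafConfig (k : ℕ) : (n : ℕ) → BinTreeVertex n → ℕ
  | 0 => fun _ => k
  | n + 1 => glueConfig 0 fun b => cond b 0 (leftmostLeafConfig k n)

/-- One pebble on a leaf of each subtree of height one. -/
def sparseConfig : (n : ℕ) → BinTreeVertex (n + 1) → ℕ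
  | 0 => leftmostLeafConfig 1 1
  | n + 1 => glueConfig 0 fun _ => sparseConfig n

/-- One pebble on a leaf of each subtree of height one, with `k` pebbles on the leftmost leaf. -/
def leftHeavyConfig (k : ℕ) : (n : ℕ) → BinTreeVertex (n + 1) → ℕ
  | 0 => leftmostLeafConfig k 1
  | n + 1 => glueConfig 0 fun b => cond b (sparseConfig n) (leftHeavyConfig k n)

theorem theorem7 :
    dominationCoverPebblingNumber (completeBinaryTree 0) = 1 ∧
    dominationCoverPebblingNumber (completeBinaryTree 1) = 2 ∧
    dominationCoverPebblingNumber (completeBinaryTree 2) = 11 ∧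
    dominationCoverPebblingNumber (completeBinaryTree 3) = 81 ∧
    dominationCoverPebblingNumber (completeBinaryTree 4) = 609 := by
  refine ⟨?_, ?_, ?_, ?_, ?_⟩
  · refine dominationCoverPebblingNumber_eq_succ (fun C hC => hasDominationCover_iff.2 ?_)
      (C₀ := 0) (by simp) ?_
    · rw [netFlow_zero_bounds C hC]
      simp [pebbleOutput]
    · rw [hasDominationCover_iff]
      decide
  · refine dominationCoverPebblingNumber_eq_succ (fun C hC => hasDominationCover_iff.2 ?_)
      (C₀ := leftHeavyConfig 1 0) (by decide) ?_
    · have := netFlow_one_bounds C hC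
      omega
    · rw [hasDominationCover_iff]
      decide
  · refine dominationCoverPebblingNumber_eq_succ (fun C hC => hasDominationCover_iff.2 ?_)
      -- The pile would need `2 + 8 = 10` to reach both vertices of depth one; a wasted pebble on
      -- the other side makes 10 in all.
      (C₀ := leftHeavyConfig 9 1) (by decide) ?_
    · exact (netFlow_two_bounds C hC).1 le_rfl
    · rw [hasDominationCover_iff]
      decide
  · refine dominationCoverPebblingNumber_eq_succ (fun C hC => hasDominationCover_iff.2 ?_)
      -- The pile would need `2 + 8 + 2 * 32` for the vertices of depth two and 4 for a child of the
      -- root, which is 78; there are three wasted pebbles.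
      (C₀ := leftHeavyConfig 77 2) (by decide) ?_
    · exact (netFlow_three_bounds C hC).1 le_rfl
    · rw [hasDominationCover_iff]
      decide
  · refine dominationCoverPebblingNumber_eq_succ (fun C hC => hasDominationCover_iff.2 ?_)
      -- The pile would need `2 + 8 + 2 * 32 + 4 * 128` for the vertices of depth three and 16 for
      -- the root, which is 602; there are seven wasted pebbles.
      (C₀ := leftHeavyConfig 601 3) (by decide +kernel) ?_
    · exact netFlow_four_dom_nonneg C hC.ge
    · rw [hasDominationCover_iff]
      decide +kernel
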